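/- **Proposition 3.3.** Let $X$ be a real normed linear space and $p\in\{1,2,3,\dots\}\cup\{\infty\}$. Fix one of the following three kinds of smoothness: for a normed linear space $Y$ and an open set $U\subset X$, a function $g:U\to Y$ is called *smooth* on $U$ if, respectively, 1. $g$ is of class $C^p$ on $U$ (in the Fréchet sense), or 2. $g$ is continuous and $p$ times Fréchet differentiable on $U$, or 3. $g$ is continuous and $p$ times Gateaux differentiable on $U$ (each derivative being the Gateaux derivative, a bounded linear operator, of the preceding one as a map into a normed space of bounded operators; for $p=\infty$, derivatives of all orders). Let $\mathcal F(X,Y)$ be the class of all functions $X\to Y$ that are smooth on $X$. Then the following statements are equivalent. * (a) $X$ admits $\mathcal F(X,\mathbb R)$-partition of unity: for every open cover $\mathcal U$ of $X$ there is a locally finite family $\{\psi_\gamma\}_{\gamma\in\Gamma}\subset\mathcal F(X,\mathbb R)$ with $\sum_\gamma\psi_\gamma=1$ on $X$ such that each closed support $\overline{\{\psi_\gamma\ne0\}}$ is contained in some member of $\mathcal U$. * (b) For every normed linear space $Y$, every nonempty closed $F\subset X$, every function $f:F\to Y$ and every $L:F\to\mathcal L(X,Y)$ that is Baire one (a pointwise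 limit of a sequence of continuous functions $F\to\mathcal L(X,Y)$), there is $\bar f:X\to Y$ such that (i) $\bar f=f$ on $F$; (ii) if $a\in F$ and $f$ is continuous at $a$ with respect to $F$, then $\bar f$ is continuous at $a$; (iii) if $a\in F$, $\alpha\in(0,1]$ and $f$ is $\alpha$-Hölder continuous at $a$ with respect to $F$ (that is, $a$ is isolated in $F$ or $\limsup_{x\to a,\,x\in F}\|f(x)-f(a)\|/\|x-a\|^\alpha<\infty$), then $\bar f$ is $\alpha$-Hölder continuous at $a$; (iv) if $a\in F$ and $L(a)$ is a relative Fréchet derivative of $f$ at $a$ with respect to $F$ (that is, $a$ is isolated in $F$ or $\lim_{x\to a,\,x\in F}\|f(x)-f(a)-L(a)(x-a)\|/\|x-a\|=0$), then $\bar f$ is Fréchet differentiable at $a$ and $\bar f'(a)=L(a)$; (v) $\bar f$ is continuous on $X\setminus F$; (vi) $\bar f$ is smooth on $X\setminus F$ and, moreover, every $x\in X\setminus F$ has a neighbourhood on which $\bar f$ coincides with a function from $\mathcal F(X,Y)$. * (c) For every nonempty closed $F\subset X$ and every $f:F\to\mathbb R$ that has a relative Fréchet derivative at each point of $F$, there is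 $\bar f:X\to\mathbb R$ that satisfies (i) and (ii) and is smooth on $X\setminus F$. * (c′) For every nonempty closed $F\subset X$ and every locally constant $f:F\to\mathbb R$, there is $\bar f:X\to\mathbb R$ that satisfies (i) and (ii) and is smooth on $X\setminus F$. -/

import Mathlib

open Set Filter Topology

universe u v

section Differentiability

variable {X : Type u} [NormedAddCommGroup X] [NormedSpace ℝ X]
  {Y : Type v} [NormedAddCommGroup Y] [NormedSpace ℝ Y]

/-- The bounded linear operator `f'` is the Gateaux derivative of `f` at `x`: for each `v`, the
map `t ↦ f (x + t • v)` has derivative `f' v` at `0`. -/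
def HasGateauxDerivAt (f : X → Y) (f' : X →L[ℝ] Y) (x : X) : Prop :=
  ∀ v : X, HasLineDerivAt ℝ f (f' v) x v

/-- `f` is `p` times Fréchet differentiable on `U` (meant for open `U`): there are successive
derivatives `D · 0 = f`, `D · 1`, ... on `U`, where the `(m+1)`-st is the Fréchet derivative of the
`m`-th one for `m < p`. Iterated derivatives are viewed as continuous multilinear maps, as in
`HasFTaylorSeriesUpToOn`; no continuity of the top derivative is required. -/
def FrechetDiffOn (p : ℕ∞) (f : X → Y) (U : Set X) : Prop :=
  ∃ D : X → FormalMultilinearSeries ℝ X Y,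
    (∀ x ∈ U, (D x 0).curry0 = f x) ∧
    ∀ m : ℕ, (m : ℕ∞) < p → ∀ x ∈ U, HasFDerivAt (fun y => D y m) (D x (m + 1)).curryLeft x

/-- `f` is `p` times Gateaux differentiable on `U` (meant for open `U`): as `FrechetDiffOn`, with
each derivative taken in the Gateaux sense, as a map into the normed space of continuous
multilinear maps. -/
def GateauxDiffOn (p : ℕ∞) (f : X → Y) (U : Set X) : Prop :=
  ∃ D : X → FormalMultilinearSeries ℝ X Y,
    (∀ x ∈ U, (D x 0).curry0 = f x) ∧
    ∀ m : ℕ, (m : ℕ∞) < p → ∀ x ∈ U, HasGateauxDerivAt (fun y => D y m) (D x (m + 1)).curryLeft x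

/-- The three kinds of `p`-smoothness. -/
inductive SmoothKind
  | contDiff
  | frechet
  | gateaux

/-- `f` is, on the open set `U`: of class `C^p`; or continuous and `p` times Fréchet
differentiable; or continuous and `p` times Gateaux differentiable. -/
def SmoothOn (κ : SmoothKind) (p : ℕ∞) (f : X → Y) (U : Set X) : Prop :=
  match κ with
  | .contDiff => ContDiffOn ℝ p f U
  | .frechet => ContinuousOn f U ∧ FrechetDiffOn p f U
  | .gateaux => ContinuousOn f U ∧ GateauxDiffOn p f U

variable (X Y) in
/-- The class of all functions `X → Y` that are `p`-smooth of kind `κ` on the whole of `X`. -/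
def SmoothClass (κ : SmoothKind) (p : ℕ∞) : Set (X → Y) :=
  {g | SmoothOn κ p g univ}

/-- `g|_U` is of class `𝓕`: near each point of `U`, `g` is a restriction of a member of `𝓕`. -/
def IsOfClassOn (𝓕 : Set (X → Y)) (g : X → Y) (U : Set X) : Prop :=
  ∀ x ∈ U, ∃ V ∈ 𝓝 x, ∃ G ∈ 𝓕, EqOn g G V

/-- `T` is a relative Fréchet derivative of `f : A → Y` at `a` with respect to `A`. At an isolated
point `a` of `A` the filter is trivial, so each `T` qualifies. -/
def IsRelFrechetDerivAt {A : Set X} (f : A → Y) (T : X →L[ℝ] Y) (a : A) : Prop :=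
  Tendsto (fun x : A => ‖f x - f a - T ((x : X) - (a : X))‖ / ‖(x : X) - (a : X)‖)
    (𝓝[≠] a) (𝓝 0)

end Differentiability

/-- `f` is `α`-Hölder continuous at the point `a`: the limit superior of
`‖f x - f a‖ / dist x a ^ α` as `x → a`, `x ≠ a`, is finite, or `a` is isolated. -/
def HolderContinuousAt {M : Type u} [MetricSpace M] {Y : Type v} [NormedAddCommGroup Y]
    (α : ℝ) (f : M → Y) (a : M) : Prop :=
  IsBoundedUnder (· ≤ ·) (𝓝[≠] a) fun x => ‖f x - f a‖ / dist x a ^ α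

/-- A Baire one function: a pointwise limit of a sequence of continuous functions. -/
def IsBaireOne {M : Type u} [TopologicalSpace M] {Z : Type v} [TopologicalSpace Z]
    (L : M → Z) : Prop :=
  ∃ g : ℕ → M → Z, (∀ n, Continuous (g n)) ∧ ∀ x, Tendsto (fun n => g n x) atTop (𝓝 (L x))

/-- `X` admits `𝓕`-partition of unity: for each open cover of `X` there is a locally finite
family of members of `𝓕` with sum `1` such that the closed support of each member is contained in
some element of the cover. -/
def AdmitsPartitionOfUnity {X : Type u} [TopologicalSpace X] (𝓕 : Set (X → ℝ)) : Prop :=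
  ∀ 𝒰 : Set (Set X), (∀ W ∈ 𝒰, IsOpen W) → ⋃₀ 𝒰 = univ →
    ∃ (Γ : Type u) (ψ : Γ → X → ℝ),
      (∀ γ, ψ γ ∈ 𝓕) ∧
      LocallyFinite (fun γ => Function.support (ψ γ)) ∧
      (∀ x, ∑ᶠ γ, ψ γ x = 1) ∧
      ∀ γ, ∃ W ∈ 𝒰, tsupport (ψ γ) ⊆ W

section Extension

variable {X : Type u} [NormedAddCommGroup X] [NormedSpace ℝ X]
  {Y : Type v} [NormedAddCommGroup Y] [NormedSpace ℝ Y]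

/-- `fbar` extends `f : F → Y`, is continuous at each point of `F` at which `f` is continuous with
respect to `F`, and is `p`-smooth of kind `κ` on `X \ F`. -/
structure IsContSmoothExtension (κ : SmoothKind) (p : ℕ∞) {F : Set X} (f : F → Y)
    (fbar : X → Y) : Prop where
  ext : ∀ a : F, fbar a = f a
  cont : ∀ a : F, ContinuousAt f a → ContinuousAt fbar a
  smooth_compl : SmoothOn κ p fbar Fᶜ

/-- All the conclusions of the extension theorem for `f : F → Y` and `L : F → 𝓛(X, Y)`. -/
structure IsFullExtension (κ : SmoothKind) (p : ℕ∞) {F : Set X} (f : F → Y)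
    (L : F → X →L[ℝ] Y) (fbar : X → Y) : Prop extends IsContSmoothExtension κ p f fbar where
  holder : ∀ (a : F) (α : ℝ), 0 < α → α ≤ 1 → HolderContinuousAt α f a →
    HolderContinuousAt α fbar (a : X)
  frechet : ∀ a : F, IsRelFrechetDerivAt f (L a) a → HasFDerivAt fbar (L a) (a : X)
  cont_compl : ContinuousOn fbar Fᶜ
  class_compl : IsOfClassOn (SmoothClass X Y κ p) fbar Fᶜ

end Extension

-- All four statements are equivalent to the existence of smooth Urysohn functions
-- (`HasUrysohnFunctions`). If `s` and `t` are disjoint and closed, the function equal to 0 on `s`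
-- and 1 on `t` is locally constant on `s ∪ t`. Composing its extension with a smooth step that is
-- constant near 0 and near 1 repairs smoothness on `s ∪ t`. A partition of unity gives the same
-- input by summing the members whose supports miss `s`. Conversely, Urysohn functions give bump
-- coverings, hence partitions of unity.
--
-- The remaining direction is a Whitney-type extension. Off `F` put `fbar x = ∑ ρ i x • (f (b i) + T
-- i (x - b i))`, where `ρ` is a smooth partition of unity on `Fᶜ` with supports small relative to
-- the distance to `F`, and `b i ∈ F` is an almost nearest point to `i`. The operators come from
-- `IsBaireOne.exists_approx`: `‖T x - L a‖ * infDist x F = o(dist x a)` at each `a ∈ F`.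
-- Convergence of `T` to `L a` is not needed, because `T i` only acts on vectors of length
-- comparable to `infDist i F`. Continuity, Hölder and Fréchet estimates then pass to `fbar` by
-- convexity.

universe w

/-! ### Calculus of higher Fréchet and Gateaux derivatives. -/

section KindDerivative

variable {X : Type u} [NormedAddCommGroup X] [NormedSpace ℝ X]
  {Y : Type*} [NormedAddCommGroup Y] [NormedSpace ℝ Y]
  {Z : Type*} [NormedAddCommGroup Z] [NormedSpace ℝ Z]
  {W : Type*} [NormedAddCommGroup W] [NormedSpace ℝ W]

/-- The notion of derivative underlying a kind of smoothness. -/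
def HasKindDerivAt (κ : SmoothKind) (f : X → Y) (f' : X →L[ℝ] Y) (x : X) : Prop :=
  match κ with
  | .gateaux => HasGateauxDerivAt f f' x
  | _ => HasFDerivAt f f' x

theorem HasFDerivAt.hasGateauxDerivAt {f : X → Y} {f' : X →L[ℝ] Y} {x : X}
    (h : HasFDerivAt f f' x) : HasGateauxDerivAt f f' x :=
  fun v => h.hasLineDerivAt v

theorem HasFDerivAt.hasKindDerivAt {f : X → Y} {f' : X →L[ℝ] Y} {x : X}
    (h : HasFDerivAt f f' x) (κ : SmoothKind) : HasKindDerivAt κ f f' x := by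
  cases κ
  exacts [h, h, h.hasGateauxDerivAt]

namespace HasKindDerivAt

variable {κ : SmoothKind} {x : X}

theorem unique {f : X → Y} {f' g' : X →L[ℝ] Y} (h : HasKindDerivAt κ f f' x)
    (h' : HasKindDerivAt κ f g' x) : f' = g' := by
  cases κ
  · exact HasFDerivAt.unique h h'
  · exact HasFDerivAt.unique h h'
  · ext v
    exact HasDerivAt.unique (h v) (h' v)

theorem congr_of_eventuallyEq {f g : X → Y} {f' : X →L[ℝ] Y} (h : HasKindDerivAt κ f f' x)
    (e : g =ᶠ[𝓝 x] f) : HasKindDerivAt κ g f' x := by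
  cases κ
  · exact HasFDerivAt.congr_of_eventuallyEq h e
  · exact HasFDerivAt.congr_of_eventuallyEq h e
  · intro v
    exact (h v).congr_of_eventuallyEq e

theorem clm_comp {f : X → Y} {f' : X →L[ℝ] Y} (h : HasKindDerivAt κ f f' x) (T : Y →L[ℝ] Z) :
    HasKindDerivAt κ (fun y => T (f y)) (T.comp f') x := by
  cases κ
  · exact T.hasFDerivAt.comp x h
  · exact T.hasFDerivAt.comp x h
  · intro v
    exact T.hasFDerivAt.comp_hasDerivAt (0 : ℝ) (h v)

theorem add {f g : X → Y} {f' g' : X →L[ℝ] Y} (h : HasKindDerivAt κ f f' x)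
    (h' : HasKindDerivAt κ g g' x) : HasKindDerivAt κ (fun y => f y + g y) (f' + g') x := by
  cases κ
  · exact HasFDerivAt.add h h'
  · exact HasFDerivAt.add h h'
  · intro v
    exact HasDerivAt.add (h v) (h' v)

theorem bilinear {f : X → Y} {g : X → Z} {f' : X →L[ℝ] Y} {g' : X →L[ℝ] Z}
    (h : HasKindDerivAt κ f f' x) (h' : HasKindDerivAt κ g g' x) (B : Y →L[ℝ] Z →L[ℝ] W) :
    HasKindDerivAt κ (fun y => B (f y) (g y))
      (B.precompR X (f x) g' + B.precompL X f' (g x)) x := by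
  cases κ
  · exact B.hasFDerivAt_of_bilinear h h'
  · exact B.hasFDerivAt_of_bilinear h h'
  · intro v
    have := B.hasDerivAt_of_bilinear (fun _ => h v) (fun _ => h' v)
    simpa [HasLineDerivAt] using this

theorem scomp {f : X → ℝ} {f' : X →L[ℝ] ℝ} {θ : ℝ → ℝ} {c : ℝ} (h : HasKindDerivAt κ f f' x)
    (hθ : HasDerivAt θ c (f x)) : HasKindDerivAt κ (fun y => θ (f y)) (c • f') x := by
  cases κ
  · exact hθ.comp_hasFDerivAt x h
  · exact hθ.comp_hasFDerivAt x h
  · intro v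
    have hθ' : HasDerivAt θ c (f (x + (0 : ℝ) • v)) := by simpa using hθ
    exact hθ'.comp (0 : ℝ) (h v)

end HasKindDerivAt

/-- `D` is a series of successive derivatives of `f` on `U`, up to the order `p`. -/
def IsKindSeriesOn (κ : SmoothKind) (p : ℕ∞) (D : X → FormalMultilinearSeries ℝ X Y)
    (f : X → Y) (U : Set X) : Prop :=
  (∀ x ∈ U, (D x 0).curry0 = f x) ∧
    ∀ m : ℕ, (m : ℕ∞) < p → ∀ x ∈ U,
      HasKindDerivAt κ (fun y => D y m) (D x (m + 1)).curryLeft x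

/-- `f` is `p` times differentiable on `U` in the sense of the kind `κ`. -/
def KindDiffOn (κ : SmoothKind) (p : ℕ∞) (f : X → Y) (U : Set X) : Prop :=
  ∃ D : X → FormalMultilinearSeries ℝ X Y, IsKindSeriesOn κ p D f U

theorem IsKindSeriesOn.mono {κ : SmoothKind} {p q : ℕ∞} {D : X → FormalMultilinearSeries ℝ X Y}
    {f g : X → Y} {U V : Set X} (h : IsKindSeriesOn κ p D f U) (hq : q ≤ p) (hV : V ⊆ U)
    (hfg : EqOn g f V) : IsKindSeriesOn κ q D g V :=
  ⟨fun x hx => (h.1 x (hV hx)).trans (hfg hx).symm,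
    fun m hm x hx => h.2 m (hm.trans_le hq) x (hV hx)⟩

/-- Derivatives of either kind are unique and depend only on the germ of the function, so induction
on the order applies on an open set. This is what lets local series be glued. -/
theorem IsKindSeriesOn.unique {κ : SmoothKind} {m : ℕ}
    {D D' : X → FormalMultilinearSeries ℝ X Y} {f : X → Y} {U : Set X} (hU : IsOpen U)
    (h : IsKindSeriesOn κ m D f U) (h' : IsKindSeriesOn κ m D' f U) {x : X} (hx : x ∈ U) :
    D x m = D' x m := by
  induction m generalizing x with
  | zero =>
    have := (h.1 x hx).trans (h'.1 x hx).symm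
    exact (continuousMultilinearCurryFin0 ℝ X Y).injective this
  | succ m ih =>
    have hm : (m : ℕ∞) < ((m + 1 : ℕ) : ℕ∞) := by exact_mod_cast m.lt_succ_self
    have e : (fun y => D' y m) =ᶠ[𝓝 x] fun y => D y m := by
      filter_upwards [hU.mem_nhds hx] with y hy
      exact (ih (h.mono hm.le Subset.rfl fun _ _ => rfl)
        (h'.mono hm.le Subset.rfl fun _ _ => rfl) hy).symm
    have := (h.2 m hm x hx).congr_of_eventuallyEq e |>.unique (h'.2 m hm x hx)
    exact (continuousMultilinearCurryLeftEquiv ℝ (fun _ : Fin (m + 1) => X) Y).injective this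

namespace KindDiffOn

variable {κ : SmoothKind} {p : ℕ∞} {U : Set X}

theorem mono {q : ℕ∞} {f g : X → Y} {V : Set X} (h : KindDiffOn κ p f U) (hq : q ≤ p)
    (hV : V ⊆ U) (hfg : EqOn g f V) : KindDiffOn κ q g V :=
  let ⟨D, hD⟩ := h
  ⟨D, hD.mono hq hV hfg⟩

/-- The neighbourhood and the series may depend on the finite order `n`, so the case `p = ∞` reduces
to finite orders, where induction is available. -/
theorem of_locally {f : X → Y} (hU : IsOpen U)
    (h : ∀ x ∈ U, ∀ n : ℕ, (n : ℕ∞) ≤ p → ∃ V, IsOpen V ∧ x ∈ V ∧ KindDiffOn κ n f V) :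
    KindDiffOn κ p f U := by
  classical
  choose! V hVo hxV D hD using h
  have key : ∀ x ∈ U, ∀ n : ℕ, (n : ℕ∞) ≤ p → ∀ m ≤ n, ∀ y ∈ U, y ∈ V x n →
      D y m y m = D x n y m := by
    intro x hx n hn m hm y hy hyx
    have hmp : (m : ℕ∞) ≤ p := le_trans (by exact_mod_cast hm) hn
    refine IsKindSeriesOn.unique ((hVo y hy m hmp).inter (hVo x hx n hn))
      ((hD y hy m hmp).mono le_rfl inter_subset_left fun _ _ => rfl)
      ((hD x hx n hn).mono (by exact_mod_cast hm) inter_subset_right fun _ _ => rfl)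
      ⟨hxV y hy m hmp, hyx⟩
  -- Diagonal choice: the term of order `m` at `y` is read from the series of order `m` chosen at
  -- `y`. By `key` it agrees near `x` with the series of order `m + 1` chosen at `x`, which can be
  -- differentiated.
  refine ⟨fun y m => D y m y m, fun x hx => ?_, fun m hm x hx => ?_⟩
  · exact (hD x hx 0 (by simp)).1 x (hxV x hx 0 (by simp))
  · have hm' : ((m + 1 : ℕ) : ℕ∞) ≤ p := by
      rw [Nat.cast_add, Nat.cast_one]
      exact Order.add_one_le_of_lt hm
    have := (hD x hx (m + 1) hm').2 m (by exact_mod_cast m.lt_succ_self) x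
      (hxV x hx (m + 1) hm')
    refine this.congr_of_eventuallyEq ?_
    filter_upwards [(hVo x hx (m + 1) hm').mem_nhds (hxV x hx (m + 1) hm'), hU.mem_nhds hx]
      with y hy hyU
    exact key x hx (m + 1) hm' m m.le_succ y hyU hy

theorem of_forall_nat {f : X → Y} (hU : IsOpen U)
    (h : ∀ n : ℕ, (n : ℕ∞) ≤ p → KindDiffOn κ n f U) : KindDiffOn κ p f U :=
  of_locally hU fun _ hx n hn => ⟨U, hU, hx, h n hn⟩

theorem zero (f : X → Y) : KindDiffOn κ (0 : ℕ) f U :=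
  ⟨fun x m => match m with
    | 0 => ContinuousMultilinearMap.uncurry0 ℝ X (f x)
    | _ + 1 => 0, fun _ _ => rfl, fun m hm => absurd hm (by simp)⟩

/-- This recursion on the first derivative drives the inductions for the product and chain rules. -/
theorem succ_iff {n : ℕ} {f : X → Y} (hU : IsOpen U) :
    KindDiffOn κ (n + 1 : ℕ) f U ↔
      ∃ f' : X → X →L[ℝ] Y, (∀ x ∈ U, HasKindDerivAt κ f (f' x) x) ∧ KindDiffOn κ n f' U := by
  constructor
  · rintro ⟨D, hD0, hD⟩
    refine ⟨fun x => continuousMultilinearCurryFin1 ℝ X Y (D x 1), fun x hx => ?_,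
      fun x => (D x).shift, fun x hx => ?_, fun m hm x hx => ?_⟩
    · have h1 := (hD 0 (by simp) x hx).clm_comp
        (continuousMultilinearCurryFin0 ℝ X Y).toContinuousLinearEquiv.toContinuousLinearMap
      have h2 := h1.congr_of_eventuallyEq (g := f) (by
        filter_upwards [hU.mem_nhds hx] with y hy
        exact (hD0 y hy).symm)
      convert h2 using 1
      ext v
      simp
    · ext v
      rfl
    · have h1 := (hD (m + 1) (by exact_mod_cast Nat.succ_lt_succ (by exact_mod_cast hm)) x
        hx).clm_comp (Z := X [×m]→L[ℝ] (X →L[ℝ] Y))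
        (continuousMultilinearCurryRightEquiv' ℝ m X Y).toContinuousLinearEquiv.toContinuousLinearMap
      -- Differentiation adds a variable on the left while `shift` splits one off on the right; the
      -- two operations commute by `Fin.cons_snoc_eq_snoc_cons`.
      have e : ((D x).shift (m + 1)).curryLeft =
          (continuousMultilinearCurryRightEquiv' ℝ m X
            Y).toContinuousLinearEquiv.toContinuousLinearMap.comp (D x (m + 1 + 1)).curryLeft := by
        ext v w z
        change D x (m + 1 + 1) (Fin.snoc (Fin.cons v w) z) = D x (m + 1 + 1) (Fin.cons v (Fin.snoc w z))
        rw [Fin.cons_snoc_eq_snoc_cons]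
      change HasKindDerivAt κ _ ((D x).shift (m + 1)).curryLeft x
      rw [e]
      exact h1
  · rintro ⟨f', hf', D', hD0, hD⟩
    refine ⟨fun x => (D' x).unshift (f x), fun x hx => rfl, fun m hm x hx => ?_⟩
    cases m with
    | zero =>
      have h1 := (hf' x hx).clm_comp (Z := X [×0]→L[ℝ] Y)
        (continuousMultilinearCurryFin0 ℝ X Y).symm.toContinuousLinearEquiv.toContinuousLinearMap
      have e : ((D' x).unshift (f x) 1).curryLeft =
          (continuousMultilinearCurryFin0 ℝ X
            Y).symm.toContinuousLinearEquiv.toContinuousLinearMap.comp (f' x) := by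
        ext v w
        rw [← hD0 x hx]
        change D' x 0 (Fin.init (α := fun _ => X) (Fin.cons (α := fun _ => X) v w)) (Fin.cons (α := fun _ => X) v w (Fin.last 0)) =
          D' x 0 0 v
        rw [Subsingleton.elim (Fin.init (α := fun _ => X) (Fin.cons (α := fun _ => X) v w)) 0]
        rfl
      change HasKindDerivAt κ _ ((D' x).unshift (f x) 1).curryLeft x
      rw [e]
      exact h1
    | succ m =>
      have h1 := (hD m (by exact_mod_cast Nat.lt_of_succ_lt_succ (by exact_mod_cast hm)) x
        hx).clm_comp (Z := X [×(m + 1)]→L[ℝ] Y)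
        (continuousMultilinearCurryRightEquiv' ℝ m X
          Y).symm.toContinuousLinearEquiv.toContinuousLinearMap
      have e : ((D' x).unshift (f x) (m + 2)).curryLeft =
          (continuousMultilinearCurryRightEquiv' ℝ m X
            Y).symm.toContinuousLinearEquiv.toContinuousLinearMap.comp
              (D' x (m + 1)).curryLeft := by
        ext v w
        change D' x (m + 1) (Fin.init (α := fun _ => X) (Fin.cons (α := fun _ => X) v w))
            (Fin.cons (α := fun _ => X) v w (Fin.last (m + 1))) =
          D' x (m + 1) (Fin.cons v (Fin.init w)) (w (Fin.last m))
        congr 2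
        rw [← Fin.snoc_init_self w, Fin.cons_snoc_eq_snoc_cons, Fin.init_snoc, Fin.init_snoc]
      change HasKindDerivAt κ _ ((D' x).unshift (f x) (m + 2)).curryLeft x
      rw [e]
      exact h1

theorem clm_comp {f : X → Y} (h : KindDiffOn κ p f U) (T : Y →L[ℝ] Z) :
    KindDiffOn κ p (fun x => T (f x)) U := by
  obtain ⟨D, hD0, hD⟩ := h
  refine ⟨fun x m => T.compContinuousMultilinearMap (D x m), fun x hx => ?_, fun m hm x hx => ?_⟩
  · exact congrArg T (hD0 x hx)
  · exact (hD m hm x hx).clm_comp (T.compContinuousMultilinearMapL ℝ (fun _ : Fin m => X) Y Z)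

theorem add {f g : X → Y} (h : KindDiffOn κ p f U) (h' : KindDiffOn κ p g U) :
    KindDiffOn κ p (fun x => f x + g x) U := by
  obtain ⟨D, hD0, hD⟩ := h
  obtain ⟨D', hD0', hD'⟩ := h'
  refine ⟨fun x m => D x m + D' x m, fun x hx => ?_, fun m hm x hx => ?_⟩
  · exact congrArg₂ (· + ·) (hD0 x hx) (hD0' x hx)
  · exact (hD m hm x hx).add (hD' m hm x hx)

/-- Leibniz rule by induction on `n`. The derivative is a sum of bilinear terms with values in `X
→L[ℝ] G`, so the spaces change along the induction; a universe containing that of `X` stays fixed.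
`smul_nat` reaches other universes through `ULift`. -/
theorem bilinear_nat (hU : IsOpen U) (n : ℕ) :
    ∀ {E F G : Type max u w} [NormedAddCommGroup E] [NormedSpace ℝ E] [NormedAddCommGroup F]
      [NormedSpace ℝ F] [NormedAddCommGroup G] [NormedSpace ℝ G] (B : E →L[ℝ] F →L[ℝ] G)
      {f : X → E} {g : X → F}, KindDiffOn κ n f U → KindDiffOn κ n g U →
      KindDiffOn κ n (fun x => B (f x) (g x)) U := by
  induction n with
  | zero => exact fun _ _ _ _ _ => zero _
  | succ n ih =>
    intro E F G _ _ _ _ _ _ B f g hf hg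
    have hn : (n : ℕ∞) ≤ ((n + 1 : ℕ) : ℕ∞) := by exact_mod_cast n.le_succ
    have hfn : KindDiffOn κ n f U := hf.mono hn Subset.rfl fun _ _ => rfl
    have hgn : KindDiffOn κ n g U := hg.mono hn Subset.rfl fun _ _ => rfl
    obtain ⟨f', hf', hfd⟩ := (succ_iff hU).1 hf
    obtain ⟨g', hg', hgd⟩ := (succ_iff hU).1 hg
    refine (succ_iff hU).2 ⟨fun x => B.precompR X (f x) (g' x) + B.precompL X (f' x) (g x),
      fun x hx => (hf' x hx).bilinear (hg' x hx) B, ?_⟩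
    exact (ih (B.precompR X) hfn hgd).add (ih (B.precompL X) hfd hgn)

theorem smul_nat {E : Type v} [NormedAddCommGroup E] [NormedSpace ℝ E] (hU : IsOpen U) (n : ℕ)
    {f : X → ℝ} {g : X → E} (hf : KindDiffOn κ n f U) (hg : KindDiffOn κ n g U) :
    KindDiffOn κ n (fun x => f x • g x) U := by
  let e : ℝ ≃L[ℝ] ULift.{max u v} ℝ := ContinuousLinearEquiv.ulift.symm
  let e' : E ≃L[ℝ] ULift.{max u v} E := ContinuousLinearEquiv.ulift.symm
  let B : ULift.{max u v} ℝ →L[ℝ] ULift.{max u v} E →L[ℝ] ULift.{max u v} E :=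
    (ContinuousLinearMap.lsmul ℝ ℝ).comp (e.symm : ULift.{max u v} ℝ →L[ℝ] ℝ)
  have h1 := hf.clm_comp (e : ℝ →L[ℝ] ULift.{max u v} ℝ)
  have h2 := hg.clm_comp (e' : E →L[ℝ] ULift.{max u v} E)
  exact (bilinear_nat.{u, max u v} hU n B h1 h2).clm_comp (e'.symm : ULift.{max u v} E →L[ℝ] E)

theorem smul {E : Type v} [NormedAddCommGroup E] [NormedSpace ℝ E] (hU : IsOpen U)
    {f : X → ℝ} {g : X → E} (hf : KindDiffOn κ p f U) (hg : KindDiffOn κ p g U) :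
    KindDiffOn κ p (fun x => f x • g x) U :=
  of_forall_nat hU fun n hn => smul_nat hU n (hf.mono hn Subset.rfl fun _ _ => rfl)
    (hg.mono hn Subset.rfl fun _ _ => rfl)

theorem scomp_nat (hU : IsOpen U) (n : ℕ) {f : X → ℝ} {θ : ℝ → ℝ}
    (hθ : ContDiff ℝ (⊤ : ℕ∞) θ) (hf : KindDiffOn κ n f U) :
    KindDiffOn κ n (fun x => θ (f x)) U := by
  induction n generalizing θ with
  | zero => exact zero _
  | succ n ih =>
    have hn : (n : ℕ∞) ≤ ((n + 1 : ℕ) : ℕ∞) := by exact_mod_cast n.le_succ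
    obtain ⟨f', hf', hfd⟩ := (succ_iff hU).1 hf
    have hθ' := contDiff_infty_iff_deriv.1 hθ
    exact (succ_iff hU).2 ⟨fun x => deriv θ (f x) • f' x,
      fun x hx => (hf' x hx).scomp (hθ'.1 (f x)).hasDerivAt,
      (ih hθ'.2 (hf.mono hn Subset.rfl fun _ _ => rfl)).smul_nat hU n hfd⟩

theorem scomp (hU : IsOpen U) {f : X → ℝ} {θ : ℝ → ℝ}
    (hθ : ContDiff ℝ (⊤ : ℕ∞) θ) (hf : KindDiffOn κ p f U) :
    KindDiffOn κ p (fun x => θ (f x)) U :=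
  of_forall_nat hU fun n hn => scomp_nat hU n hθ (hf.mono hn Subset.rfl fun _ _ => rfl)

theorem of_contDiff {f : X → Y} (hf : ContDiff ℝ (⊤ : ℕ∞) f) : KindDiffOn κ p f U := by
  obtain ⟨D, hD⟩ : ∃ D, HasFTaylorSeriesUpTo (⊤ : ℕ∞) f D := ⟨_, hf.ftaylorSeries⟩
  refine ⟨D, fun x _ => hD.zero_eq x, fun m _ x _ => ?_⟩
  exact (hD.fderiv m (by exact_mod_cast ENat.natCast_lt_top m) x).hasKindDerivAt κ

end KindDiffOn

end KindDerivative

/-! ### Closure properties shared by the three kinds of smoothness. -/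

section SmoothOn

variable {X : Type u} [NormedAddCommGroup X] [NormedSpace ℝ X]
  {Y : Type v} [NormedAddCommGroup Y] [NormedSpace ℝ Y]
  {Z : Type w} [NormedAddCommGroup Z] [NormedSpace ℝ Z]

theorem smoothOn_iff_of_ne_contDiff {κ : SmoothKind} {p : ℕ∞} {f : X → Y} {U : Set X}
    (hκ : κ ≠ .contDiff) : SmoothOn κ p f U ↔ ContinuousOn f U ∧ KindDiffOn κ p f U := by
  cases κ
  exacts [absurd rfl hκ, Iff.rfl, Iff.rfl]

namespace SmoothOn

variable {κ : SmoothKind} {p : ℕ∞} {U : Set X}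

theorem continuousOn {f : X → Y} (h : SmoothOn κ p f U) : ContinuousOn f U := by
  cases κ
  exacts [ContDiffOn.continuousOn h, h.1, h.1]

theorem mono {f g : X → Y} {V : Set X} (h : SmoothOn κ p f U) (hV : V ⊆ U)
    (hfg : EqOn g f V) : SmoothOn κ p g V := by
  by_cases hκ : κ = .contDiff
  · subst hκ
    exact (ContDiffOn.mono h hV).congr hfg
  · rw [smoothOn_iff_of_ne_contDiff hκ] at h ⊢
    exact ⟨(h.1.mono hV).congr hfg, h.2.mono le_rfl hV hfg⟩

theorem of_locally {f : X → Y} (hU : IsOpen U)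
    (h : ∀ x ∈ U, ∃ V, IsOpen V ∧ x ∈ V ∧ SmoothOn κ p f V) : SmoothOn κ p f U := by
  by_cases hκ : κ = .contDiff
  · subst hκ
    intro x hx
    obtain ⟨V, hV, hxV, hf⟩ := h x hx
    exact (ContDiffOn.contDiffAt hf (hV.mem_nhds hxV)).contDiffWithinAt
  · simp only [smoothOn_iff_of_ne_contDiff hκ] at h ⊢
    refine ⟨fun x hx => ?_, KindDiffOn.of_locally hU fun x hx n hn => ?_⟩
    · obtain ⟨V, hV, hxV, hf⟩ := h x hx
      exact (hf.1.continuousAt (hV.mem_nhds hxV)).continuousWithinAt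
    · obtain ⟨V, hV, hxV, hf⟩ := h x hx
      exact ⟨V, hV, hxV, hf.2.mono hn Subset.rfl fun _ _ => rfl⟩

theorem of_contDiff {f : X → Y} (hf : ContDiff ℝ (⊤ : ℕ∞) f) : SmoothOn κ p f U := by
  by_cases hκ : κ = .contDiff
  · subst hκ
    exact (hf.of_le (by exact_mod_cast le_top)).contDiffOn
  · rw [smoothOn_iff_of_ne_contDiff hκ]
    exact ⟨hf.continuous.continuousOn, KindDiffOn.of_contDiff hf⟩

theorem clm_comp {f : X → Y} (h : SmoothOn κ p f U) (T : Y →L[ℝ] Z) :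
    SmoothOn κ p (fun x => T (f x)) U := by
  by_cases hκ : κ = .contDiff
  · subst hκ
    exact T.contDiff.comp_contDiffOn h
  · rw [smoothOn_iff_of_ne_contDiff hκ] at h ⊢
    exact ⟨T.continuous.comp_continuousOn h.1, h.2.clm_comp T⟩

theorem add {f g : X → Y} (h : SmoothOn κ p f U) (h' : SmoothOn κ p g U) :
    SmoothOn κ p (fun x => f x + g x) U := by
  by_cases hκ : κ = .contDiff
  · subst hκ
    exact ContDiffOn.add h h'
  · rw [smoothOn_iff_of_ne_contDiff hκ] at h h' ⊢
    exact ⟨h.1.add h'.1, h.2.add h'.2⟩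

theorem smul {f : X → ℝ} {g : X → Y} (hU : IsOpen U) (h : SmoothOn κ p f U)
    (h' : SmoothOn κ p g U) : SmoothOn κ p (fun x => f x • g x) U := by
  by_cases hκ : κ = .contDiff
  · subst hκ
    exact ContDiffOn.smul h h'
  · rw [smoothOn_iff_of_ne_contDiff hκ] at h h' ⊢
    exact ⟨h.1.smul h'.1, h.2.smul hU h'.2⟩

theorem scomp {f : X → ℝ} {θ : ℝ → ℝ} (hU : IsOpen U) (hθ : ContDiff ℝ (⊤ : ℕ∞) θ)
    (h : SmoothOn κ p f U) : SmoothOn κ p (fun x => θ (f x)) U := by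
  by_cases hκ : κ = .contDiff
  · subst hκ
    exact (hθ.of_le (by exact_mod_cast le_top)).comp_contDiffOn h
  · rw [smoothOn_iff_of_ne_contDiff hκ] at h ⊢
    exact ⟨hθ.continuous.comp_continuousOn h.1, h.2.scomp hU hθ⟩

theorem sum {ι : Type*} {f : ι → X → Y} (s : Finset ι) (h : ∀ i ∈ s, SmoothOn κ p (f i) U) :
    SmoothOn κ p (fun x => ∑ i ∈ s, f i x) U := by
  classical
  induction s using Finset.induction_on with
  | empty => simpa using of_contDiff contDiff_const
  | insert i s hi ih =>
    simp only [Finset.sum_insert hi]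
    exact (h i (Finset.mem_insert_self i s)).add
      (ih fun j hj => h j (Finset.mem_insert_of_mem hj))

theorem prod {ι : Type*} {f : ι → X → ℝ} (hU : IsOpen U) (s : Finset ι)
    (h : ∀ i ∈ s, SmoothOn κ p (f i) U) : SmoothOn κ p (fun x => ∏ i ∈ s, f i x) U := by
  classical
  induction s using Finset.induction_on with
  | empty => simpa using of_contDiff contDiff_const
  | insert i s hi ih =>
    simp only [Finset.prod_insert hi]
    exact (h i (Finset.mem_insert_self i s)).smul hU
      (ih fun j hj => h j (Finset.mem_insert_of_mem hj))

end SmoothOn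

theorem IsOfClassOn.smoothOn {κ : SmoothKind} {p : ℕ∞} {f : X → Y} {U : Set X} (hU : IsOpen U)
    (h : IsOfClassOn (SmoothClass X Y κ p) f U) : SmoothOn κ p f U := by
  refine SmoothOn.of_locally hU fun x hx => ?_
  obtain ⟨V, hV, G, hG, hfG⟩ := h x hx
  obtain ⟨W, hWV, hW, hxW⟩ := mem_nhds_iff.1 hV
  exact ⟨W, hW, hxW, SmoothOn.mono hG (subset_univ W) (hfG.mono hWV)⟩

end SmoothOn

/-! ### Smooth Urysohn functions and partitions of unity. -/

section Urysohn

variable {X : Type u} [NormedAddCommGroup X] [NormedSpace ℝ X] {κ : SmoothKind} {p : ℕ∞}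

/-- Disjoint closed sets can be separated by members of `𝓕` with values in `[0, 1]`. -/
def HasUrysohnFunctions {X : Type u} [TopologicalSpace X] (𝓕 : Set (X → ℝ)) : Prop :=
  ∀ s t : Set X, IsClosed s → IsClosed t → Disjoint s t →
    ∃ φ ∈ 𝓕, EqOn φ 0 s ∧ EqOn φ 1 t ∧ ∀ x, φ x ∈ Icc (0 : ℝ) 1

theorem exists_smooth_urysohn_of_continuous {s t : Set X} {g : X → ℝ} (hs : IsClosed s)
    (ht : IsClosed t) (hg : Continuous g) (hgs : EqOn g 0 s) (hgt : EqOn g 1 t)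
    (h : SmoothOn κ p g (s ∪ t)ᶜ) :
    ∃ φ ∈ SmoothClass X ℝ κ p, EqOn φ 0 s ∧ EqOn φ 1 t ∧ ∀ x, φ x ∈ Icc (0 : ℝ) 1 := by
  -- This step is 0 for `c ≤ 1/3` and 1 for `c ≥ 2/3`, so the composite with `g` is constant near
  -- each point of `s ∪ t`, where `g` is only continuous.
  have hθ : ContDiff ℝ (⊤ : ℕ∞) fun c : ℝ => Real.smoothTransition (3 * c - 1) :=
    Real.smoothTransition.contDiff.comp ((contDiff_const.mul contDiff_id).sub contDiff_const)
  refine ⟨fun x => Real.smoothTransition (3 * g x - 1), ?_, fun x hx => ?_, fun x hx => ?_,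
    fun x => ⟨Real.smoothTransition.nonneg _, Real.smoothTransition.le_one _⟩⟩
  · refine SmoothOn.of_locally isOpen_univ fun x _ => ?_
    by_cases hxs : x ∈ s
    · refine ⟨{y | g y < 1 / 3}, isOpen_lt hg continuous_const, ?_,
        (SmoothOn.of_contDiff (contDiff_const (c := (0 : ℝ)))).mono (subset_univ _)
          fun y hy => Real.smoothTransition.zero_of_nonpos ?_⟩
      · simp [hgs hxs]
      · linarith [show g y < 1 / 3 from hy]
    by_cases hxt : x ∈ t
    · refine ⟨{y | 2 / 3 < g y}, isOpen_lt continuous_const hg, ?_,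
        (SmoothOn.of_contDiff (contDiff_const (c := (1 : ℝ)))).mono (subset_univ _)
          fun y hy => Real.smoothTransition.one_of_one_le ?_⟩
      · simp [hgt hxt]
        norm_num
      · linarith [show 2 / 3 < g y from hy]
    · have ho : IsOpen (s ∪ t)ᶜ := (hs.union ht).isOpen_compl
      exact ⟨(s ∪ t)ᶜ, ho, by simp [hxs, hxt],
        h.scomp (θ := fun c => Real.smoothTransition (3 * c - 1)) ho hθ⟩
  · exact Real.smoothTransition.zero_of_nonpos (by simp [hgs hx])
  · exact Real.smoothTransition.one_of_one_le (by simp [hgt hx]; norm_num)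

theorem hasUrysohnFunctions_of_extension
    (h : ∀ F : Set X, F.Nonempty → IsClosed F → ∀ f : F → ℝ, IsLocallyConstant f →
      ∃ fbar : X → ℝ, IsContSmoothExtension κ p f fbar) :
    HasUrysohnFunctions (SmoothClass X ℝ κ p) := by
  classical
  intro s t hs ht hst
  rcases (s ∪ t).eq_empty_or_nonempty with hF | hF
  · obtain ⟨rfl, rfl⟩ := union_empty_iff.1 hF
    exact ⟨fun _ => 0, SmoothOn.of_contDiff contDiff_const, by simp, by simp, by simp⟩
  have hlc : IsLocallyConstant fun x : ↥(s ∪ t) => if (x : X) ∈ s then (0 : ℝ) else 1 := by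
    rw [IsLocallyConstant.iff_eventually_eq]
    intro x
    by_cases hx : (x : X) ∈ s
    · filter_upwards [continuousAt_subtype_val.preimage_mem_nhds
        (ht.isOpen_compl.mem_nhds (disjoint_left.1 hst hx))] with y hy
      simp [hx, y.2.resolve_right hy]
    · filter_upwards [continuousAt_subtype_val.preimage_mem_nhds
        (hs.isOpen_compl.mem_nhds hx)] with y hy
      simp [hx, show (y : X) ∉ s from hy]
  obtain ⟨g, hg⟩ := h (s ∪ t) hF (hs.union ht) _ hlc
  refine exists_smooth_urysohn_of_continuous hs ht (continuous_iff_continuousAt.2 fun x => ?_)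
    (fun x hx => ?_) (fun x hx => ?_) hg.smooth_compl
  · by_cases hx : x ∈ s ∪ t
    · exact hg.cont ⟨x, hx⟩ hlc.continuous.continuousAt
    · exact hg.smooth_compl.continuousOn.continuousAt
        ((hs.union ht).isOpen_compl.mem_nhds hx)
  · rw [hg.ext ⟨x, Or.inl hx⟩]
    simp [hx]
  · rw [hg.ext ⟨x, Or.inr hx⟩]
    simp [disjoint_right.1 hst hx]

theorem AdmitsPartitionOfUnity.hasUrysohnFunctions
    (h : AdmitsPartitionOfUnity (SmoothClass X ℝ κ p)) :
    HasUrysohnFunctions (SmoothClass X ℝ κ p) := by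
  classical
  intro s t hs ht hst
  obtain ⟨Γ, ψ, hψ, hlf, hsum, hsub⟩ := h {sᶜ, tᶜ} (by
    rintro W (rfl | rfl)
    exacts [hs.isOpen_compl, ht.isOpen_compl]) (by
    rw [sUnion_pair, ← compl_inter, hst.inter_eq, compl_empty])
  -- The members in `A` vanish on `s`; those outside `A` have support in `tᶜ`, so on `t` the sum
  -- over `A` is the full sum 1. The `ψ γ` may be negative: values in `[0, 1]` come from the final
  -- smooth step.
  let A : Set Γ := {γ | tsupport (ψ γ) ⊆ sᶜ}
  let χ : Γ → X → ℝ := fun γ => if γ ∈ A then ψ γ else fun _ => 0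
  have hχ0 : ∀ γ x, ψ γ x = 0 → χ γ x = 0 := by
    intro γ x hx
    by_cases hγ : γ ∈ A <;> simp [χ, hγ, hx]
  have hχs : ∀ γ, SmoothOn κ p (χ γ) univ := by
    intro γ
    by_cases hγ : γ ∈ A
    · simp only [χ, hγ, if_true]
      exact hψ γ
    · simp only [χ, hγ, if_false]
      exact SmoothOn.of_contDiff contDiff_const
  have hsmooth : SmoothOn κ p (fun x => ∑ᶠ γ, χ γ x) univ := by
    refine SmoothOn.of_locally isOpen_univ fun x _ => ?_
    obtain ⟨V, hV, hfin⟩ := hlf x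
    obtain ⟨W, hWV, hW, hxW⟩ := mem_nhds_iff.1 hV
    refine ⟨W, hW, hxW, (SmoothOn.sum hfin.toFinset fun γ _ => hχs γ).mono (subset_univ W) ?_⟩
    intro y hy
    refine finsum_eq_sum_of_support_subset _ fun γ hγ => ?_
    simp only [Finite.coe_toFinset]
    exact ⟨y, fun h0 => hγ (hχ0 γ y h0), hWV hy⟩
  refine exists_smooth_urysohn_of_continuous hs ht
    (continuousOn_univ.1 hsmooth.continuousOn) (fun x hx => ?_) (fun x hx => ?_)
    (hsmooth.mono (subset_univ _) fun _ _ => rfl)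
  · refine (finsum_congr fun γ => ?_).trans finsum_zero
    by_cases hγ : γ ∈ A
    · exact hχ0 γ x (image_eq_zero_of_notMem_tsupport fun hx' => hγ hx' hx)
    · simp [χ, hγ]
  · refine Eq.trans (finsum_congr fun γ => ?_) (hsum x)
    by_cases hγ : γ ∈ A
    · simp [χ, hγ]
    · obtain ⟨W, hW, hγW⟩ := hsub γ
      rcases hW with rfl | rfl
      · exact absurd hγW hγ
      · have h0 : ψ γ x = 0 := image_eq_zero_of_notMem_tsupport fun hx' => hγW hx' hx
        rw [h0, hχ0 γ x h0]

/-- A bump covering yields the partition `f i * ∏ (1 - f j)` over `j` before `i` in a well-order;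
locally the product is finite, hence smooth. -/
theorem HasUrysohnFunctions.admitsPartitionOfUnity
    (h : HasUrysohnFunctions (SmoothClass X ℝ κ p)) :
    AdmitsPartitionOfUnity (SmoothClass X ℝ κ p) := by
  classical
  intro 𝒰 h𝒰 hcov
  obtain ⟨f, hf, hfU⟩ := BumpCovering.exists_isSubordinate_of_prop
    (fun g : X → ℝ => g ∈ SmoothClass X ℝ κ p)
    (fun s t hs ht hst => by
      obtain ⟨φ, hφ, h0, h1, hI⟩ := h s t hs ht hst
      exact ⟨⟨φ, continuousOn_univ.1 (SmoothOn.continuousOn hφ)⟩, hφ, h0, h1, hI⟩)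
    isClosed_univ (fun W : 𝒰 => (W : Set X)) (fun W => h𝒰 W W.2)
    (by rw [← sUnion_eq_iUnion, hcov])
  refine ⟨𝒰, fun i => f.toPartitionOfUnity i, fun i => ?_, f.toPartitionOfUnity.locallyFinite,
    fun x => f.toPartitionOfUnity.sum_eq_one (mem_univ x),
    fun i => ⟨i, i.2, hfU.toPartitionOfUnity i⟩⟩
  refine SmoothOn.of_locally isOpen_univ fun x _ => ?_
  obtain ⟨t, ht⟩ := f.exists_finset_toPartitionOfUnity_eventuallyEq i x
  obtain ⟨W, hWt, hW, hxW⟩ := mem_nhds_iff.1 ht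
  have hone : ∀ j, SmoothOn κ p (fun y => 1 - f j y) univ := fun j =>
    (hf j).scomp isOpen_univ (contDiff_const.sub contDiff_id)
  refine ⟨W, hW, hxW, (SmoothOn.smul isOpen_univ (hf i) (SmoothOn.prod isOpen_univ
    (t.filter fun j => WellOrderingRel j i) fun j _ => hone j)).mono (subset_univ W) ?_⟩
  intro y hy
  simpa using hWt hy

end Urysohn

/-! ### Approximating a Baire one map near a closed set. -/

section BaireOne

/-- Radial truncation at radius `n + 1` preserves continuity and, at each point, changes only
finitely many terms of a convergent sequence. -/
theorem IsBaireOne.exists_norm_le {M : Type*} [TopologicalSpace M] {Z : Type*}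
    [NormedAddCommGroup Z] [NormedSpace ℝ Z] {L : M → Z} (hL : IsBaireOne L) :
    ∃ h : ℕ → M → Z, (∀ n, Continuous (h n)) ∧ (∀ n x, ‖h n x‖ ≤ n + 1) ∧
      ∀ x, Tendsto (fun n => h n x) atTop (𝓝 (L x)) := by
  obtain ⟨g, hg, hgL⟩ := hL
  have hpos : ∀ (n : ℕ) x, 0 < max ((n : ℝ) + 1) ‖g n x‖ := fun n x =>
    lt_max_of_lt_left (by positivity)
  refine ⟨fun n x => (((n : ℝ) + 1) / max ((n : ℝ) + 1) ‖g n x‖) • g n x, fun n => ?_,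
    fun n x => ?_, fun x => ?_⟩
  · exact (continuous_const.div (continuous_const.max (hg n).norm)
      fun x => (hpos n x).ne').smul (hg n)
  · rw [norm_smul, Real.norm_of_nonneg (div_nonneg (by positivity) (hpos n x).le), div_mul_eq_mul_div,
      div_le_iff₀ (hpos n x)]
    gcongr
    exact le_max_right _ _
  · refine (hgL x).congr' ?_
    have h1 : ∀ᶠ n : ℕ in atTop, ‖L x‖ + 1 ≤ (n : ℝ) :=
      tendsto_natCast_atTop_atTop.eventually_ge_atTop _
    filter_upwards [h1, (hgL x).norm.eventually_lt_const (lt_add_one ‖L x‖)] with n hn hn'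
    rw [max_eq_left (by linarith), div_self (by positivity), one_smul]

/-- Take `T x = h n b` with `b ∈ F` close to `x` and `n` the largest index for which `h n` is nearly
constant on the part of `F` within `R n x` of `x`. As `x → a` this index tends to infinity. Either
`a` lies within that radius and `h n b ≈ h n a ≈ L a`, or `infDist x F` is so small against `dist x
a` that the bound `n + 1` on `‖h n‖` suffices. -/
theorem IsBaireOne.exists_approx {X : Type*} [MetricSpace X] {Z : Type*}
    [NormedAddCommGroup Z] [NormedSpace ℝ Z] {F : Set X} (hF : F.Nonempty) (hFc : IsClosed F)
    {L : F → Z} (hL : IsBaireOne L) :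
    ∃ T : X → Z, ∀ (a : F) (ε : ℝ), 0 < ε →
      ∀ᶠ x in 𝓝 (a : X), ‖T x - L a‖ * Metric.infDist x F ≤ ε * dist x a := by
  classical
  obtain ⟨h, hc, hb, hlim⟩ := hL.exists_norm_le
  have := hF.to_subtype
  let R : ℕ → X → ℝ := fun n x => 2 * ((n : ℝ) + 1) ^ 2 * Metric.infDist x F
  -- The first condition bounds `n` when `x ∉ F`; the product form makes `n = 0` always admissible,
  -- so a largest index exists.
  let C : ℕ → X → Prop := fun n x => n * Metric.infDist x F ≤ 1 ∧
    ∀ y z : F, dist x y < R n x → dist x z < R n x → n * ‖h n y - h n z‖ ≤ 1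
  have hd : ∀ (a : F) x, Metric.infDist x F ≤ dist x a := fun a x =>
    Metric.infDist_le_dist_of_mem a.2
  have hmax : ∀ x ∉ F, ∃ (n : ℕ) (y : F), C n x ∧ (∀ m, C m x → m ≤ n) ∧ dist x y < R n x := by
    intro x hx
    have hpos : 0 < Metric.infDist x F := (hFc.notMem_iff_infDist_pos hF).1 hx
    have hbdd : BddAbove {n | C n x} := by
      refine ⟨⌈1 / Metric.infDist x F⌉₊, fun n hn => ?_⟩
      have : (n : ℝ) ≤ 1 / Metric.infDist x F := (le_div_iff₀ hpos).2 hn.1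
      exact_mod_cast this.trans (Nat.le_ceil _)
    have hne : {n | C n x}.Nonempty := ⟨0, by simp [C]⟩
    have hlt : Metric.infDist x F < R (sSup {n | C n x}) x := by
      simp only [R]
      have : (1 : ℝ) ≤ (((sSup {n | C n x} : ℕ) : ℝ) + 1) ^ 2 :=
        one_le_pow₀ (by linarith [Nat.cast_nonneg (α := ℝ) (sSup {n | C n x})])
      nlinarith
    obtain ⟨y, hy, hxy⟩ := (Metric.infDist_lt_iff hF).1 hlt
    exact ⟨sSup {n | C n x}, ⟨y, hy⟩, Nat.sSup_mem hne hbdd, fun m hm => le_csSup hbdd hm, hxy⟩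
  choose! N b hN hNmax hbR using hmax
  have hev : ∀ (a : F) (m : ℕ), ∀ᶠ x in 𝓝 (a : X), C m x := by
    intro a m
    have h1 : ∀ᶠ x in 𝓝 (a : X), m * Metric.infDist x F < 1 := by
      have : Tendsto (fun x => m * Metric.infDist x F) (𝓝 (a : X)) (𝓝 0) := by
        have := ((Metric.continuous_infDist_pt F).tendsto (a : X)).const_mul (m : ℝ)
        rwa [Metric.infDist_zero_of_mem a.2, mul_zero] at this
      exact this.eventually_lt_const one_pos
    obtain ⟨δ, hδ, hcont⟩ := Metric.continuousAt_iff.1 ((hc m).continuousAt (x := a))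
      (1 / (2 * ((m : ℝ) + 1))) (by positivity)
    -- A point of `F` within `R m x` of `x` is within `(2(m+1)² + 1) * dist x a` of `a`.
    have hq : (0 : ℝ) < 2 * ((m : ℝ) + 1) ^ 2 + 1 := by positivity
    filter_upwards [h1, Metric.ball_mem_nhds (a : X) (div_pos hδ hq)] with x hx hxa
    rw [Metric.mem_ball, lt_div_iff₀ hq] at hxa
    have hclose : ∀ y : F, dist x y < R m x → ‖h m y - h m a‖ < 1 / (2 * ((m : ℝ) + 1)) := by
      intro y hy
      rw [← dist_eq_norm]
      refine hcont ?_
      have h2 : R m x ≤ 2 * ((m : ℝ) + 1) ^ 2 * dist x a := by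
        simp only [R]
        gcongr
        exact hd a x
      have h3 : dist (y : X) a ≤ dist x y + dist x a := dist_triangle_left _ _ _
      rw [Subtype.dist_eq]
      linarith
    refine ⟨hx.le, fun y z hy hz => ?_⟩
    have h2 : ‖h m y - h m z‖ ≤ ‖h m y - h m a‖ + ‖h m z - h m a‖ := by
      rw [← dist_eq_norm, ← dist_eq_norm, ← dist_eq_norm]
      exact dist_triangle_right _ _ _
    have h3 : ‖h m y - h m z‖ ≤ 1 / ((m : ℝ) + 1) := by
      have : 1 / (2 * ((m : ℝ) + 1)) + 1 / (2 * ((m : ℝ) + 1)) = 1 / ((m : ℝ) + 1) := by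
        field_simp
        norm_num
      linarith [hclose y hy, hclose z hz]
    calc (m : ℝ) * ‖h m y - h m z‖ ≤ (m : ℝ) * (1 / ((m : ℝ) + 1)) := by gcongr
      _ ≤ 1 := by
        rw [mul_one_div, div_le_one (by positivity)]
        linarith
  refine ⟨fun x => h (N x) (b x), fun a ε hε => ?_⟩
  have hA : ∀ᶠ n : ℕ in atTop, ‖h n a - L a‖ < ε / 2 :=
    (tendsto_iff_norm_sub_tendsto_zero.1 (hlim a)).eventually_lt_const (half_pos hε)
  have hB : ∀ᶠ n : ℕ in atTop, max (2 / ε) ((1 + ‖L a‖) / ε) ≤ (n : ℝ) :=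
    tendsto_natCast_atTop_atTop.eventually_ge_atTop _
  obtain ⟨M, hM⟩ := eventually_atTop.1 (hA.and hB)
  filter_upwards [hev a M] with x hx
  by_cases hxF : x ∈ F
  · rw [Metric.infDist_zero_of_mem hxF, mul_zero]
    positivity
  obtain ⟨h1, h2⟩ := hM (N x) (hNmax x hxF M hx)
  have h3 : 2 ≤ N x * ε := (div_le_iff₀ hε).1 ((le_max_left _ _).trans h2)
  have h4 : 1 + ‖L a‖ ≤ N x * ε := (div_le_iff₀ hε).1 ((le_max_right _ _).trans h2)
  have hd0 : 0 ≤ Metric.infDist x F := Metric.infDist_nonneg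
  have hN0 : (0 : ℝ) < N x := by
    by_contra! h0
    nlinarith
  by_cases hxa : dist x a < R (N x) x
  · have h5 := (hN x hxF).2 (b x) a (hbR x hxF) hxa
    have h6 : ‖h (N x) (b x) - h (N x) a‖ ≤ ε / 2 := by
      by_contra! h7
      nlinarith
    have h7 : ‖h (N x) (b x) - L a‖ ≤ ε := by
      have := norm_sub_le_norm_sub_add_norm_sub (h (N x) (b x)) (h (N x) a) (L a)
      linarith
    exact mul_le_mul h7 (hd a x) hd0 hε.le
  · have h5 : 2 * ((N x : ℝ) + 1) ^ 2 * Metric.infDist x F ≤ dist x a := not_lt.1 hxa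
    have h6 : ‖h (N x) (b x) - L a‖ ≤ (N x + 1) + ‖L a‖ :=
      (norm_sub_le _ _).trans (by gcongr; exact hb _ _)
    have h7 : ((N x : ℝ) + 1) + ‖L a‖ ≤ ε * (2 * ((N x : ℝ) + 1) ^ 2) := by
      have := norm_nonneg (L a)
      nlinarith [mul_nonneg hN0.le this]
    calc ‖h (N x) (b x) - L a‖ * Metric.infDist x F
        ≤ ε * (2 * ((N x : ℝ) + 1) ^ 2) * Metric.infDist x F := by
          gcongr
          exact h6.trans h7
      _ = ε * (2 * ((N x : ℝ) + 1) ^ 2 * Metric.infDist x F) := by ring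
      _ ≤ ε * dist x a := by gcongr

end BaireOne

/-! ### Whitney-type extension. -/

section Whitney

variable {X : Type u} [NormedAddCommGroup X] [NormedSpace ℝ X] {κ : SmoothKind} {p : ℕ∞}

theorem HasUrysohnFunctions.exists_partition_compl
    (h : HasUrysohnFunctions (SmoothClass X ℝ κ p)) {F : Set X} (hF : F.Nonempty)
    (hFc : IsClosed F) :
    ∃ ρ : ↥Fᶜ → X → ℝ, (∀ i x, 0 ≤ ρ i x) ∧
      (∀ i x, ρ i x ≠ 0 → 4 * dist x i < Metric.infDist (i : X) F) ∧
      (∀ x ∉ F, ∑ᶠ i, ρ i x = 1) ∧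
      ∀ x ∉ F, ∃ V ∈ 𝓝 x, ∃ s : Finset ↥Fᶜ, (∀ y ∈ V, ∀ i ∉ s, ρ i y = 0) ∧
        ∀ i ∈ s, ∃ G ∈ SmoothClass X ℝ κ p, EqOn (ρ i) G V := by
  classical
  have hU : IsOpen Fᶜ := hFc.isOpen_compl
  have hpos : ∀ x ∉ F, 0 < Metric.infDist x F := fun x hx =>
    (hFc.notMem_iff_infDist_pos hF).1 hx
  obtain ⟨v, hvo, hvc, hvf, hvs⟩ := precise_refinement
    (fun c : ↥Fᶜ => {y : ↥Fᶜ | 4 * dist (y : X) c < Metric.infDist (c : X) F})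
    (fun c => isOpen_lt (by fun_prop) continuous_const)
    (eq_univ_of_forall fun c => mem_iUnion.2 ⟨c, by simpa using hpos c c.2⟩)
  obtain ⟨v', hv'c, hv'o, hv's⟩ := exists_iUnion_eq_closure_subset hvo hvf.point_finite hvc
  -- The closure is taken in `X`, where the Urysohn functions live. It cannot reach `F`, since `v'
  -- i` stays within a quarter of the distance from `i` to `F`.
  have hdisj : ∀ i, Disjoint (Subtype.val '' v i)ᶜ (closure (Subtype.val '' v' i)) := by
    intro i
    refine disjoint_compl_left_iff_subset.2 fun y hy => ?_
    have hyd : 4 * dist y i ≤ Metric.infDist (i : X) F := by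
      have hcl : IsClosed {y : X | 4 * dist y i ≤ Metric.infDist (i : X) F} :=
        isClosed_le (by fun_prop) continuous_const
      refine closure_minimal ?_ hcl hy
      rintro _ ⟨z, hz, rfl⟩
      exact le_of_lt (show 4 * dist (z : X) i < _ from hvs i (hv's i (subset_closure hz)))
    have hyF : y ∉ F := by
      intro hyF
      have h1 := Metric.infDist_le_dist_of_mem (x := (i : X)) hyF
      have h2 := hpos i i.2
      rw [dist_comm] at h1
      linarith
    exact ⟨⟨y, hyF⟩, hv's i (closure_subtype.2 hy), rfl⟩
  choose φ hφ hφ0 hφ1 hφI using fun i => h _ _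
    ((hU.isOpenMap_subtype_val _ (hvo i)).isClosed_compl) isClosed_closure (hdisj i)
  have hφv : ∀ i (y : ↥Fᶜ), φ i y ≠ 0 → y ∈ v i := by
    intro i y hy
    by_contra hyv
    refine hy (hφ0 i ?_)
    rintro ⟨z, hz, hzy⟩
    exact hyv (Subtype.ext hzy ▸ hz)
  let f : BumpCovering ↥Fᶜ ↥Fᶜ :=
    { toFun := fun i => ⟨fun y => φ i y,
        (continuousOn_univ.1 (SmoothOn.continuousOn (hφ i))).comp continuous_subtype_val⟩
      locallyFinite' := hvf.subset fun i y hy => hφv i y hy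
      nonneg' := fun i y => (hφI i y).1
      le_one' := fun i y => (hφI i y).2
      eventuallyEq_one' := by
        intro x _
        obtain ⟨i, hi⟩ := mem_iUnion.1 (hv'c ▸ mem_univ x)
        refine ⟨i, ?_⟩
        filter_upwards [(hv'o i).mem_nhds hi] with y hy
        exact hφ1 i (subset_closure ⟨y, hy, rfl⟩) }
  have hf : ∀ i (y : ↥Fᶜ), f i y = φ i y := fun _ _ => rfl
  let ρ : ↥Fᶜ → X → ℝ := fun i x => if hx : x ∈ Fᶜ then f.toPartitionOfUnity i ⟨x, hx⟩ else 0
  have hρ : ∀ i x (hx : x ∈ Fᶜ), ρ i x = f.toPartitionOfUnity i ⟨x, hx⟩ := fun i x hx =>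
    dif_pos hx
  have hρv : ∀ i x (hx : x ∈ Fᶜ), ρ i x ≠ 0 → ⟨x, hx⟩ ∈ v i := by
    intro i x hx h0
    rw [hρ i x hx] at h0
    exact hφv i ⟨x, hx⟩ fun h1 => h0 (f.toPartitionOfUnity_zero_of_zero h1)
  refine ⟨ρ, fun i x => ?_, fun i x h0 => ?_, fun x hx => ?_, fun x hx => ?_⟩
  · by_cases hx : x ∈ Fᶜ
    · rw [hρ i x hx]
      exact f.toPartitionOfUnity.nonneg i _
    · exact (show ρ i x = 0 from dif_neg hx).ge
  · by_cases hx : x ∈ Fᶜ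
    · exact hvs i (hρv i x hx h0)
    · exact absurd (dif_neg hx) h0
  · simp only [hρ _ x hx]
    exact f.toPartitionOfUnity.sum_eq_one (mem_univ _)
  · obtain ⟨N, hN, hfin⟩ := hvf ⟨x, hx⟩
    have hloc : ∀ i, ∃ t : Finset ↥Fᶜ, f.toPartitionOfUnity i =ᶠ[𝓝 ⟨x, hx⟩]
        f i * ∏ j ∈ t with WellOrderingRel j i, (1 - f j) := fun i =>
      f.exists_finset_toPartitionOfUnity_eventuallyEq i _
    choose t ht using hloc
    have hev : ∀ᶠ y in 𝓝 (⟨x, hx⟩ : ↥Fᶜ), y ∈ N ∧ ∀ i ∈ hfin.toFinset,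
        f.toPartitionOfUnity i y = (f i * ∏ j ∈ t i with WellOrderingRel j i, (1 - f j)) y :=
      Filter.Eventually.and hN ((Filter.eventually_all_finset _).2 fun i _ => ht i)
    have hV := (hU.isOpenMap_subtype_val.image_mem_nhds hev)
    refine ⟨_, hV, hfin.toFinset, ?_, fun i hi => ?_⟩
    · rintro _ ⟨y, hy, rfl⟩ i hi
      by_contra h0
      exact hi (hfin.mem_toFinset.2 ⟨y, hρv i y y.2 h0, hy.1⟩)
    · have hone : ∀ j, SmoothOn κ p (fun y => 1 - φ j y) univ := fun j =>
        SmoothOn.scomp isOpen_univ (contDiff_const.sub contDiff_id) (hφ j)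
      refine ⟨_, SmoothOn.smul isOpen_univ (hφ i) (SmoothOn.prod isOpen_univ
        ((t i).filter fun j => WellOrderingRel j i) fun j _ => hone j), ?_⟩
      rintro _ ⟨y, hy, rfl⟩
      rw [hρ i y y.2]
      simpa [hf] using hy.2 i hi

variable {Y : Type v} [NormedAddCommGroup Y] [NormedSpace ℝ Y]

theorem HasUrysohnFunctions.exists_isFullExtension
    (h : HasUrysohnFunctions (SmoothClass X ℝ κ p)) {F : Set X} (hF : F.Nonempty)
    (hFc : IsClosed F) (f : F → Y) {L : F → X →L[ℝ] Y} (hL : IsBaireOne L) :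
    ∃ fbar : X → Y, IsFullExtension κ p f L fbar := by
  classical
  obtain ⟨T, hT⟩ := hL.exists_approx hF hFc
  obtain ⟨ρ, hρ0, hρd, hρ1, hρloc⟩ := h.exists_partition_compl hF hFc
  have hpos : ∀ x ∉ F, 0 < Metric.infDist x F := fun x hx =>
    (hFc.notMem_iff_infDist_pos hF).1 hx
  have hnear : ∀ i : ↥Fᶜ, ∃ b : F, dist (i : X) b < 2 * Metric.infDist (i : X) F := by
    intro i
    obtain ⟨y, hy, hyd⟩ := (Metric.infDist_lt_iff (x := (i : X)) hF).1
      (by linarith [hpos i i.2] : Metric.infDist (i : X) F < 2 * Metric.infDist (i : X) F)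
    exact ⟨⟨y, hy⟩, hyd⟩
  choose b hb using hnear
  let A : ↥Fᶜ → X → Y := fun i x => f (b i) + T i (x - b i)
  have hA : ∀ i, SmoothOn κ p (A i) univ := fun i => SmoothOn.of_contDiff
    (contDiff_const.add ((T i).contDiff.comp (contDiff_id.sub contDiff_const)))
  let fbar : X → Y := fun x => if hx : x ∈ F then f ⟨x, hx⟩ else ∑ᶠ i, ρ i x • A i x
  have hext : ∀ a : F, fbar a = f a := fun a => dif_pos a.2
  have hcompl : ∀ x ∉ F, fbar x = ∑ᶠ i, ρ i x • A i x := fun x hx => dif_neg hx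
  have hclass : IsOfClassOn (SmoothClass X Y κ p) fbar Fᶜ := by
    intro x hx
    obtain ⟨V, hV, s, hs, hG⟩ := hρloc x hx
    choose! G hGs hGV using hG
    refine ⟨V ∩ Fᶜ, inter_mem hV (hFc.isOpen_compl.mem_nhds hx),
      fun y => ∑ i ∈ s, G i y • A i y,
      SmoothOn.sum s fun i hi => SmoothOn.smul isOpen_univ (hGs i hi) (hA i), ?_⟩
    intro y hy
    rw [hcompl y hy.2, finsum_eq_sum_of_support_subset (s := s)]
    · exact Finset.sum_congr rfl fun i hi => by rw [hGV i hi hy.1]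
    · intro i hi
      by_contra his
      exact hi (by simp [hs y hy.1 i his])
  have hsmooth : SmoothOn κ p fbar Fᶜ := hclass.smoothOn hFc.isOpen_compl
  -- From `4 * dist x i < infDist i F ≤ dist i a` one gets `dist x i < dist x a / 3`; the other
  -- bounds follow with `dist i (b i) < 2 * infDist i F`.
  have hgeom : ∀ (a : F) (i : ↥Fᶜ) (x : X), ρ i x ≠ 0 →
      dist (i : X) a ≤ 2 * dist x a ∧ dist (b i : X) a ≤ 4 * dist x a ∧
      dist x (b i) ≤ 3 * dist x a ∧ dist x (b i) ≤ 3 * Metric.infDist (i : X) F := by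
    intro a i x h0
    have h1 := hρd i x h0
    have h2 := hb i
    have h3 : Metric.infDist (i : X) F ≤ dist (i : X) a := Metric.infDist_le_dist_of_mem a.2
    have h4 : dist (i : X) a ≤ dist x i + dist x a := dist_triangle_left _ _ _
    have h5 : dist x (b i) ≤ dist x i + dist (i : X) (b i) := dist_triangle _ _ _
    have h6 : dist (b i : X) a ≤ dist x (b i) + dist x a := dist_triangle_left _ _ _
    have h7 : 0 ≤ dist x (i : X) := dist_nonneg
    refine ⟨?_, ?_, ?_, ?_⟩ <;> linarith
  -- The factor `infDist i F` needed to control `T i - L a` is supplied by `dist x (b i) ≤ 3 *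
  -- infDist i F`. No regularity of `f` at `a` enters.
  have hTev : ∀ (a : F) (ε : ℝ), 0 < ε → ∀ᶠ x in 𝓝 (a : X), ∀ i, ρ i x ≠ 0 →
      ‖(T i - L a) (x - b i)‖ ≤ 6 * ε * dist x a := by
    intro a ε hε
    obtain ⟨δ, hδ, hball⟩ := Metric.eventually_nhds_iff.1 (hT a ε hε)
    filter_upwards [Metric.ball_mem_nhds (a : X) (half_pos hδ)] with x hx i h0
    obtain ⟨h1, -, -, h4⟩ := hgeom a i x h0
    rw [Metric.mem_ball] at hx
    have h5 := hball (show dist (i : X) a < δ by linarith)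
    calc ‖(T i - L a) (x - b i)‖ ≤ ‖T i - L a‖ * ‖x - b i‖ := (T i - L a).le_opNorm _
      _ ≤ ‖T i - L a‖ * (3 * Metric.infDist (i : X) F) := by
        gcongr
        rwa [← dist_eq_norm]
      _ = 3 * (‖T i - L a‖ * Metric.infDist (i : X) F) := by ring
      _ ≤ 3 * (ε * dist (i : X) a) := by gcongr
      _ ≤ 3 * (ε * (2 * dist x a)) := by gcongr
      _ = 6 * ε * dist x a := by ring
  have hconv : ∀ x ∉ F, ∀ (w : Y) (M : ℝ), (∀ i, ρ i x ≠ 0 → ‖A i x - w‖ ≤ M) →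
      ‖fbar x - w‖ ≤ M := by
    intro x hx w M hM
    rw [hcompl x hx, ← dist_eq_norm, ← Metric.mem_closedBall]
    refine (convex_closedBall w M).finsum_mem (fun i => hρ0 i x) (hρ1 x hx) fun i hi => ?_
    rw [Metric.mem_closedBall, dist_eq_norm]
    exact hM i hi
  have hgrowth : ∀ a : F, ∀ᶠ x in 𝓝 (a : X), ∀ i, ρ i x ≠ 0 →
      ‖A i x - f a‖ ≤ ‖f (b i) - f a‖ + (6 + 3 * ‖L a‖) * dist x a := by
    intro a
    filter_upwards [hTev a 1 one_pos] with x hx i h0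
    obtain ⟨-, -, h3, -⟩ := hgeom a i x h0
    have e : A i x - f a = (f (b i) - f a) + ((T i - L a) (x - b i) + L a (x - b i)) := by
      simp only [A, sub_apply]
      abel
    have h5 : ‖L a (x - b i)‖ ≤ ‖L a‖ * (3 * dist x a) := by
      refine ((L a).le_opNorm _).trans ?_
      rw [← dist_eq_norm]
      gcongr
    calc ‖A i x - f a‖ ≤ ‖f (b i) - f a‖ + (‖(T i - L a) (x - b i)‖ + ‖L a (x - b i)‖) := by
          rw [e]
          exact (norm_add_le _ _).trans (by gcongr; exact norm_add_le _ _)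
      _ ≤ ‖f (b i) - f a‖ + (6 * 1 * dist x a + ‖L a‖ * (3 * dist x a)) := by
          gcongr
          exact hx i h0
      _ = ‖f (b i) - f a‖ + (6 + 3 * ‖L a‖) * dist x a := by ring
  refine ⟨fbar, ⟨hext, fun a ha => ?_, hsmooth⟩, fun a α hα hα1 hH => ?_, fun a hD => ?_,
    hsmooth.continuousOn, hclass⟩
  · rw [Metric.continuousAt_iff'] at ha ⊢
    intro ε hε
    obtain ⟨δ, hδ, hfa⟩ := Metric.eventually_nhds_iff.1 (ha (ε / 2) (half_pos hε))
    have hsmall : ∀ᶠ x : X in 𝓝 (a : X), (6 + 3 * ‖L a‖) * dist x a < ε / 2 := by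
      have : Tendsto (fun x : X => (6 + 3 * ‖L a‖) * dist x (a : X)) (𝓝 (a : X)) (𝓝 0) := by
        have : Continuous fun x : X => (6 + 3 * ‖L a‖) * dist x (a : X) := by fun_prop
        simpa using this.tendsto (a : X)
      exact this.eventually_lt_const (half_pos hε)
    filter_upwards [hgrowth a, hsmall, Metric.ball_mem_nhds (a : X) (show 0 < δ / 4 by positivity)]
      with x hx hxs hxδ
    rw [Metric.mem_ball] at hxδ
    rw [hext a]
    by_cases hxF : x ∈ F
    · rw [hext ⟨x, hxF⟩]
      have := hfa (show dist (⟨x, hxF⟩ : F) a < δ by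
        rw [Subtype.dist_eq]
        linarith [dist_nonneg (x := x) (y := (a : X))])
      linarith
    · rw [dist_eq_norm]
      refine lt_of_le_of_lt (hconv x hxF (f a) (ε / 2 + (6 + 3 * ‖L a‖) * dist x a)
        fun i h0 => (hx i h0).trans ?_) (by linarith)
      gcongr
      rw [← dist_eq_norm]
      refine (hfa ?_).le
      rw [Subtype.dist_eq]
      linarith [(hgeom a i x h0).2.1]
  · obtain ⟨C, hC⟩ := hH
    rw [eventually_map, eventually_nhdsWithin_iff] at hC
    obtain ⟨δ, hδ, hfa⟩ := Metric.eventually_nhds_iff.1 hC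
    have hfa' : ∀ y : F, dist (y : X) a < δ → ‖f y - f a‖ ≤ |C| * dist (y : X) a ^ α := by
      intro y hy
      by_cases hya : y = a
      · subst hya
        simp [Real.zero_rpow hα.ne']
      · have hya' : 0 < dist (y : X) a := dist_pos.2 fun e => hya (Subtype.ext e)
        have h1 := hfa (show dist y a < δ from hy) hya
        rw [Subtype.dist_eq, div_le_iff₀ (by positivity)] at h1
        exact h1.trans (by gcongr; exact le_abs_self C)
    refine ⟨4 * |C| + (6 + 3 * ‖L a‖), ?_⟩
    rw [eventually_map, eventually_nhdsWithin_iff]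
    filter_upwards [hgrowth a, Metric.ball_mem_nhds (a : X) (show 0 < δ / 4 by positivity),
      Metric.ball_mem_nhds (a : X) one_pos] with x hx hxδ hx1 hxa
    rw [Metric.mem_ball] at hxδ hx1
    have hxa' : 0 < dist x (a : X) := dist_pos.2 hxa
    -- Here `α ≤ 1` is essential: it lets the linear term of `hgrowth` be absorbed.
    have hle : dist x (a : X) ≤ dist x (a : X) ^ α := by
      simpa using Real.rpow_le_rpow_of_exponent_ge hxa' hx1.le hα1
    have h4 : (4 : ℝ) ^ α ≤ 4 := by
      simpa using Real.rpow_le_rpow_of_exponent_le (by norm_num : (1 : ℝ) ≤ 4) hα1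
    rw [div_le_iff₀ (by positivity), hext a]
    have hp : 0 ≤ dist x (a : X) ^ α := by positivity
    by_cases hxF : x ∈ F
    · rw [hext ⟨x, hxF⟩]
      refine (hfa' ⟨x, hxF⟩ (by simpa using (by linarith : dist x (a : X) < δ))).trans ?_
      gcongr
      linarith [abs_nonneg C, norm_nonneg (L a)]
    · refine hconv x hxF _ _ fun i h0 => (hx i h0).trans ?_
      obtain ⟨-, h2, -, -⟩ := hgeom a i x h0
      have h5 : ‖f (b i) - f a‖ ≤ |C| * (4 * dist x (a : X) ^ α) := by
        refine (hfa' (b i) (by linarith)).trans ?_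
        gcongr
        calc dist (b i : X) a ^ α ≤ (4 * dist x (a : X)) ^ α := by gcongr
          _ = 4 ^ α * dist x (a : X) ^ α := Real.mul_rpow (by norm_num) dist_nonneg
          _ ≤ 4 * dist x (a : X) ^ α := by gcongr
      have h6 : (6 + 3 * ‖L a‖) * dist x (a : X) ≤ (6 + 3 * ‖L a‖) * dist x (a : X) ^ α := by
        gcongr
      linarith
  · have hD' : ∀ ε : ℝ, 0 < ε → ∃ δ > 0, ∀ y : F, dist (y : X) a < δ →
        ‖f y - f a - L a ((y : X) - a)‖ ≤ ε * dist (y : X) a := by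
      intro ε hε
      have h1 := hD.eventually_lt_const hε
      rw [eventually_nhdsWithin_iff] at h1
      obtain ⟨δ, hδ, hfa⟩ := Metric.eventually_nhds_iff.1 h1
      refine ⟨δ, hδ, fun y hy => ?_⟩
      by_cases hya : y = a
      · subst hya
        simp
      · have h2 := hfa (show dist y a < δ from hy) hya
        have hya' : 0 < ‖(y : X) - a‖ := norm_pos_iff.2 (sub_ne_zero.2 fun e => hya (Subtype.ext e))
        rw [dist_eq_norm]
        exact ((div_lt_iff₀ hya').1 h2).le
    refine HasFDerivAt.of_isLittleO (Asymptotics.isLittleO_iff.2 fun ε hε => ?_)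
    -- The 10 is 4 + 6: `dist (b i) a ≤ 4 * dist x a`, plus the constant 6 of `hTev`.
    obtain ⟨δ, hδ, hfa⟩ := hD' (ε / 10) (by positivity)
    filter_upwards [hTev a (ε / 10) (by positivity),
      Metric.ball_mem_nhds (a : X) (show 0 < δ / 4 by positivity)] with x hx hxδ
    rw [Metric.mem_ball] at hxδ
    rw [hext a, ← dist_eq_norm x]
    have hd0 : 0 ≤ dist x (a : X) := dist_nonneg
    by_cases hxF : x ∈ F
    · rw [hext ⟨x, hxF⟩]
      refine (hfa ⟨x, hxF⟩ (by simpa using (by linarith : dist x (a : X) < δ))).trans ?_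
      gcongr
      linarith
    · rw [sub_sub]
      refine hconv x hxF _ _ fun i h0 => ?_
      obtain ⟨-, h2, -, -⟩ := hgeom a i x h0
      have e : A i x - (f a + L a (x - a)) =
          (f (b i) - f a - L a ((b i : X) - a)) + (T i - L a) (x - b i) := by
        simp only [A, sub_apply, map_sub]
        abel
      calc ‖A i x - (f a + L a (x - a))‖
          ≤ ‖f (b i) - f a - L a ((b i : X) - a)‖ + ‖(T i - L a) (x - b i)‖ := by
            rw [e]
            exact norm_add_le _ _
        _ ≤ ε / 10 * (4 * dist x (a : X)) + 6 * (ε / 10) * dist x a := by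
            refine add_le_add ((hfa (b i) (by linarith)).trans ?_) (hx i h0)
            gcongr
        _ = ε * dist x a := by ring

end Whitney

theorem proposition3p3 {X : Type u} [NormedAddCommGroup X] [NormedSpace ℝ X]
    (κ : SmoothKind) (p : ℕ∞) (hp : 1 ≤ p) :
    List.TFAE [
      AdmitsPartitionOfUnity (SmoothClass X ℝ κ p),
      ∀ (Y : Type v) [NormedAddCommGroup Y] [NormedSpace ℝ Y] (F : Set X),
        F.Nonempty → IsClosed F → ∀ (f : F → Y) (L : F → X →L[ℝ] Y), IsBaireOne L →
          ∃ fbar : X → Y, IsFullExtension κ p f L fbar,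
      ∀ F : Set X, F.Nonempty → IsClosed F →
        ∀ f : F → ℝ, (∀ a : F, ∃ T : X →L[ℝ] ℝ, IsRelFrechetDerivAt f T a) →
          ∃ fbar : X → ℝ, IsContSmoothExtension κ p f fbar,
      ∀ F : Set X, F.Nonempty → IsClosed F →
        ∀ f : F → ℝ, IsLocallyConstant f →
          ∃ fbar : X → ℝ, IsContSmoothExtension κ p f fbar] := by
  tfae_have 1 → 2 := fun h Y _ _ F hF hFc f L hL =>
    h.hasUrysohnFunctions.exists_isFullExtension hF hFc f hL
  tfae_have 2 → 3 := by
    intro h F hF hFc f _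
    -- `ULift` places the real line in the universe of `Y`. Only extension, continuity and
    -- smoothness off `F` are wanted, so `L = 0` serves.
    let e : ℝ ≃L[ℝ] ULift.{v} ℝ := ContinuousLinearEquiv.ulift.symm
    obtain ⟨g, hg⟩ := h (ULift.{v} ℝ) F hF hFc (fun a => e (f a)) (fun _ => 0)
      ⟨fun _ _ => 0, fun _ => continuous_const, fun _ => tendsto_const_nhds⟩
    refine ⟨fun x => e.symm (g x), fun a => ?_, fun a ha => ?_, ?_⟩
    · rw [hg.ext a, e.symm_apply_apply]
    · exact e.symm.continuous.continuousAt.comp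
        (hg.cont a (e.continuous.continuousAt.comp ha))
    · exact hg.smooth_compl.clm_comp (e.symm : ULift.{v} ℝ →L[ℝ] ℝ)
  tfae_have 3 → 4 := by
    intro h F hF hFc f hf
    refine h F hF hFc f fun a => ⟨0, ?_⟩
    refine tendsto_const_nhds.congr' ?_
    filter_upwards [nhdsWithin_le_nhds ((IsLocallyConstant.iff_eventually_eq f).1 hf a)] with x hx
    simp [hx]
  tfae_have 4 → 1 := fun h => (hasUrysohnFunctions_of_extension h).admitsPartitionOfUnity
  tfae_finish
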